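/- Let $G$ be a (finite-dimensional, Hausdorff, second countable) real Lie group with Lie algebra $\mathfrak g=T_eG$, and let $M$ be a homogeneous $G$-space, that is, a (finite-dimensional, Hausdorff, second countable) smooth manifold without boundary with a smooth transitive left action $G\times M\to M$, $(a,x)\mapsto a.x$. For $v\in\mathfrak g$ let $\exp(v)=\gamma(1)$, where $\gamma:\mathbb R\to G$ is the unique one-parameter subgroup with $\dot\gamma(0)=v$, and define the vector field $\widetilde v$ on $M$ by $$\widetilde v_x=\frac{d}{dt}\Big|_{t=0}\exp(tv).x,\qquad x\in M.$$ Let $\{v_i\}_{i=1}^m$ be any basis of $\mathfrak g$ ($m\ge 0$). Then the curves $t\mapsto\exp(tv_i).x$ are differentiable at $t=0$ for all $i$ and all $x\in M$, the vector fields $\widetilde v_1,\dots,\widetilde v_m$ are smooth, and they form a generating set of the $C^\infty(M)$-module of smooth vector fields on $M$: for every smooth vector field $X$ on $M$ there are functions $f_1,\dots,f_m\in C^\infty(M)$ with $$X=f_1\widetilde v_1+\cdots+f_m\widetilde v_m .$$ (For $m=0$ this says that the only vector field on $M$ is $0$.) -/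

import Mathlib

open scoped Manifold ContDiff

noncomputable section

/-- `γ : ℝ → G` is a one-parameter subgroup of the Lie group `G` (a smooth group homomorphism
from `(ℝ, +)` to `G`) with initial velocity `γ'(0) = v` in `𝔤 = T₁G`. The vector `γ'(0)` has the
type `TangentSpace I (γ 0)`, which is the tangent space at `1` because `γ 0 = 1`. -/
structure IsOneParameterSubgroup {E : Type*} [NormedAddCommGroup E] [NormedSpace ℝ E]
    {H : Type*} [TopologicalSpace H] (I : ModelWithCorners ℝ E H)
    {G : Type*} [TopologicalSpace G] [ChartedSpace H G] [Group G]
    (γ : ℝ → G) (v : GroupLieAlgebra I G) : Prop where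
  map_zero : γ 0 = 1
  map_add : ∀ s t : ℝ, γ (s + t) = γ s * γ t
  smooth : ContMDiff 𝓘(ℝ, ℝ) I ∞ γ
  velocity : mfderiv 𝓘(ℝ, ℝ) I γ 0 (1 : ℝ) = v

open Classical in
/-- The exponential map of a Lie group: `exp v = γ 1`, where `γ` is the one-parameter subgroup
with `γ'(0) = v`. (In a finite-dimensional Lie group there is exactly one such `γ`, so the value
`1` of the other branch is never used.) -/
def lieExp {E : Type*} [NormedAddCommGroup E] [NormedSpace ℝ E]
    {H : Type*} [TopologicalSpace H] (I : ModelWithCorners ℝ E H)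
    {G : Type*} [TopologicalSpace G] [ChartedSpace H G] [Group G]
    (v : GroupLieAlgebra I G) : G :=
  if h : ∃ γ : ℝ → G, IsOneParameterSubgroup I γ v then h.choose 1 else 1

/-- The vector field on `M` induced by `v ∈ 𝔤` through the infinitesimal action:
its value at `x` is `d/dt|_{t=0} exp(tv) • x`. This derivative is based at `exp(0) • x = x`. -/
def infinitesimalAction {E : Type*} [NormedAddCommGroup E] [NormedSpace ℝ E]
    {H : Type*} [TopologicalSpace H] (I : ModelWithCorners ℝ E H)
    {E' : Type*} [NormedAddCommGroup E'] [NormedSpace ℝ E']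
    {H' : Type*} [TopologicalSpace H'] (I' : ModelWithCorners ℝ E' H')
    {G : Type*} [TopologicalSpace G] [ChartedSpace H G] [Group G]
    {M : Type*} [TopologicalSpace M] [ChartedSpace H' M] [MulAction G M]
    (v : GroupLieAlgebra I G) (x : M) : TangentSpace I' x :=
  mfderiv 𝓘(ℝ, ℝ) I' (fun t : ℝ => lieExp I (t • v) • x) 0 (1 : ℝ)

/-- A vector field on `M` is smooth if it is smooth as a section of the tangent bundle. -/
def IsSmoothVectorField {E : Type*} [NormedAddCommGroup E] [NormedSpace ℝ E]
    {H : Type*} [TopologicalSpace H] (I : ModelWithCorners ℝ E H)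
    {M : Type*} [TopologicalSpace M] [ChartedSpace H M] [IsManifold I ∞ M]
    (X : ∀ x : M, TangentSpace I x) : Prop :=
  ContMDiff I I.tangent ∞ (fun x => (⟨x, X x⟩ : TangentBundle I M))

/-- The finite family `X` of vector fields is a generating set of the `C^∞(M)`-module of smooth
vector fields: its members are smooth, and every smooth vector field is a linear combination of
them with coefficients in `C^∞(M)`. -/
def IsGeneratingSet {E : Type*} [NormedAddCommGroup E] [NormedSpace ℝ E]
    {H : Type*} [TopologicalSpace H] (I : ModelWithCorners ℝ E H)
    {M : Type*} [TopologicalSpace M] [ChartedSpace H M] [IsManifold I ∞ M]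
    {m : ℕ} (X : Fin m → ∀ x : M, TangentSpace I x) : Prop :=
  (∀ i, IsSmoothVectorField I (X i)) ∧
    ∀ Y : ∀ x : M, TangentSpace I x, IsSmoothVectorField I Y →
      ∃ f : Fin m → M → ℝ, (∀ i, ContMDiff I 𝓘(ℝ, ℝ) ∞ (f i)) ∧
        ∀ x : M, Y x = ∑ i, f i x • X i x

end

/-!
Write `D_x` for the derivative at `1` of the orbit map `g ↦ g • x`; the field induced by `v` is
`x ↦ D_x v`, so the point is that `D_x` is onto. A direction `w ∈ ker D_x` is a zero at `x` of the
induced field, so uniqueness of integral curves gives `exp w • x = x`. Choose bases `u` of a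
complement of `ker D_x` and `w` of `ker D_x`. By the inverse function theorem every element of `G`
near `1` is a product `exp(s₁u₁) ⋯ exp(sᵣuᵣ) exp(t₁w₁) ⋯ exp(tₖwₖ)`, whose second half fixes `x`.
The orbit map is open by Baire category, so the smooth map `s ↦ exp(s₁u₁) ⋯ exp(sᵣuᵣ) • x` covers a
neighbourhood of `x`; smooth maps do not raise Hausdorff dimension, so `dim M ≤ r = rank D_x`.

Smooth fields that span one tangent space generate all smooth fields nearby, by smoothly inverting
a square system, and the set of admissible coefficients at each point is affine, so a partition of
unity makes them global.
-/

open Set Bundle Topology Module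

section LocalGeometry

variable {E : Type*} [NormedAddCommGroup E] [NormedSpace ℝ E]
  {H : Type*} [TopologicalSpace H] {I : ModelWithCorners ℝ E H} [I.Boundaryless]
  {E' : Type*} [NormedAddCommGroup E'] [NormedSpace ℝ E']
  {H' : Type*} [TopologicalSpace H'] {I' : ModelWithCorners ℝ E' H'}
  {N : Type*} [TopologicalSpace N] [ChartedSpace H N]
  {M : Type*} [TopologicalSpace M] [ChartedSpace H' M]

theorem map_writtenInExtChartAt_nhds (f : N → M) (p : N) :
    Filter.map (writtenInExtChartAt I I' p f) (𝓝 (extChartAt I p p)) =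
      Filter.map (extChartAt I' (f p)) (Filter.map f (𝓝 p)) := by
  have hsymm : Filter.map (extChartAt I p).symm (𝓝 (extChartAt I p p)) = 𝓝 p := by
    simpa only [I.range_eq_univ, nhdsWithin_univ] using
      map_extChartAt_symm_nhdsWithin_range (I := I) p
  rw [writtenInExtChartAt, ← Filter.map_map, ← Filter.map_map, hsymm]

theorem contDiffAt_writtenInExtChartAt {n : ℕ∞ω} {f : N → M} {p : N}
    (hf : ContMDiffAt I I' n f p) :
    ContDiffAt ℝ n (writtenInExtChartAt I I' p f) (extChartAt I p p) := by
  simpa only [I.range_eq_univ, contDiffWithinAt_univ, writtenInExtChartAt] using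
    (contMDiffAt_iff.1 hf).2

variable [I'.Boundaryless]

theorem map_nhds_eq_of_mfderiv_surjective [CompleteSpace E] [CompleteSpace E'] {f : N → M} {p : N}
    (hf : ContMDiffAt I I' 1 f p) (hsurj : Function.Surjective (mfderiv I I' f p)) :
    Filter.map f (𝓝 p) = 𝓝 (f p) := by
  let D : E →L[ℝ] E' := mfderiv I I' f p
  have hderiv : HasFDerivWithinAt (writtenInExtChartAt I I' p f) D (range I) (extChartAt I p p) :=
    (hf.mdifferentiableAt one_ne_zero).hasMFDerivAt.2
  rw [I.range_eq_univ, hasFDerivWithinAt_univ] at hderiv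
  have hmap := ((contDiffAt_writtenInExtChartAt hf).hasStrictFDerivAt' hderiv
    one_ne_zero).map_nhds_eq_of_surj (LinearMap.range_eq_top.2 hsurj)
  have hvalue : writtenInExtChartAt I I' p f (extChartAt I p p) = extChartAt I' (f p) (f p) := by
    simp only [writtenInExtChartAt, Function.comp_apply, extChartAt_to_inv]
  rw [map_writtenInExtChartAt_nhds, hvalue, ← map_extChartAt_nhds_of_boundaryless] at hmap
  exact (Filter.map_eq_map_iff_of_injOn
    (hf.continuousAt (extChartAt_source_mem_nhds (f p)))
    (extChartAt_source_mem_nhds (f p)) (extChartAt I' (f p)).injOn).1 hmap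

theorem finrank_le_of_nhds_le_map_nhds [FiniteDimensional ℝ E] [FiniteDimensional ℝ E'] {f : N → M}
    {p : N} (hf : ContMDiffAt I I' 1 f p) (hle : 𝓝 (f p) ≤ Filter.map f (𝓝 p)) :
    finrank ℝ E' ≤ finrank ℝ E := by
  let F := writtenInExtChartAt I I' p f
  obtain ⟨u, hu, hFu⟩ := (contDiffAt_writtenInExtChartAt hf).contDiffOn le_rfl (by simp)
  obtain ⟨ε, hε, hball⟩ := Metric.mem_nhds_iff.1 hu
  have himage : F '' Metric.ball (extChartAt I p p) ε ∈ 𝓝 (extChartAt I' (f p) (f p)) := by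
    rw [← map_extChartAt_nhds_of_boundaryless]
    apply Filter.map_mono hle
    rw [← map_writtenInExtChartAt_nhds (I := I)]
    exact Filter.image_mem_map (Metric.ball_mem_nhds _ hε)
  have hdim := (hFu.mono hball).dimH_image_le (convex_ball _ _) subset_rfl
  rw [Real.dimH_of_mem_nhds himage, Real.dimH_of_mem_nhds (Metric.ball_mem_nhds _ hε)] at hdim
  exact_mod_cast hdim

end LocalGeometry

section VectorFields

variable {𝕜 : Type*} [NontriviallyNormedField 𝕜]
  {E : Type*} [NormedAddCommGroup E] [NormedSpace 𝕜 E]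
  {H : Type*} [TopologicalSpace H] {I : ModelWithCorners 𝕜 E H}
  {E' : Type*} [NormedAddCommGroup E'] [NormedSpace 𝕜 E']
  {H' : Type*} [TopologicalSpace H'] {I' : ModelWithCorners 𝕜 E' H'}
  {E'' : Type*} [NormedAddCommGroup E''] [NormedSpace 𝕜 E'']
  {H'' : Type*} [TopologicalSpace H''] {I'' : ModelWithCorners 𝕜 E'' H''}
  {N : Type*} [TopologicalSpace N] [ChartedSpace H N] [IsManifold I 1 N]
  {M : Type*} [TopologicalSpace M] [ChartedSpace H' M] [IsManifold I' 1 M]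
  {P : Type*} [TopologicalSpace P] [ChartedSpace H'' P] [IsManifold I'' 1 P]

theorem contMDiff_mfderiv_partial_left {m n : ℕ∞ω} {F : N × M → P}
    (hF : ContMDiff (I.prod I') I'' n F) (hmn : m + 1 ≤ n) (a : N) (v : TangentSpace I a) :
    ContMDiff I' I''.tangent m (fun x : M =>
      (⟨F (a, x), mfderiv I I'' (fun y => F (y, x)) a v⟩ : TangentBundle I'' P)) := by
  have hbase : ContMDiff I' (I.prod I').tangent m (fun x : M =>
      (equivTangentBundleProd I N I' M).symm (⟨a, v⟩, ⟨x, 0⟩)) :=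
    contMDiff_equivTangentBundleProd_symm.comp
      (contMDiff_const.prodMk (contMDiff_zeroSection 𝕜 (TangentSpace I' : M → Type _)))
  convert! (hF.contMDiff_tangentMap hmn).comp hbase using 2 with x
  let A : E →L[𝕜] E'' := mfderiv I I'' (fun y => F (y, x)) a
  let B : E' →L[𝕜] E'' := mfderiv I' I'' (fun y => F (a, y)) x
  have hsplit : mfderiv (I.prod I') I'' F (a, x) (v, (0 : E')) = A v + B 0 :=
    mfderiv_prod_eq_add_apply
      (hF.mdifferentiableAt (zero_lt_one.trans_le (le_add_self.trans hmn)).ne')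
  rw [map_zero, add_zero] at hsplit
  exact congrArg (TotalSpace.mk (F := E'') (F (a, x))) hsplit.symm

end VectorFields

section IntegralCurves

theorem contMDiff_of_isMIntegralCurve {E : Type*} [NormedAddCommGroup E] [NormedSpace ℝ E]
    {H : Type*} [TopologicalSpace H] {I : ModelWithCorners ℝ E H}
    {M : Type*} [TopologicalSpace M] [ChartedSpace H M] [IsManifold I 1 M]
    {X : ∀ x : M, TangentSpace I x}
    (hX : ContMDiff I I.tangent ∞ (fun x => (⟨x, X x⟩ : TangentBundle I M)))
    {γ : ℝ → M} (hγ : IsMIntegralCurve γ X) : ContMDiff 𝓘(ℝ, ℝ) I ∞ γ := by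
  refine contMDiff_infty.2 fun n => ?_
  induction n with
  | zero => exact contMDiff_zero_iff.2 hγ.continuous
  | succ n ih =>
    intro t₀
    refine contMDiffAt_iff_target.2 ⟨hγ.continuous.continuousAt, ?_⟩
    have hvelocity : ContDiffAt ℝ n
        (fun t => tangentCoordChange I (γ t) (γ t₀) (γ t) (X (γ t))) t₀ :=
      ((contMDiffAt_totalSpace.1
        (((hX.of_le (by exact_mod_cast le_top)).comp ih) t₀)).2).contDiffAt
    have hderiv := (hγ.isMIntegralCurveAt t₀).eventually_hasDerivAt
    rw [contMDiffAt_iff_contDiffAt]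
    push_cast
    rw [contDiffAt_succ_iff_hasFDerivAt]
    exact ⟨_, ⟨_, hderiv, fun t ht => ht.hasFDerivAt⟩,
      (ContinuousLinearMap.toSpanSingletonCLE (𝕜 := ℝ) (E := E)).contDiff.contDiffAt.comp t₀
        hvelocity⟩

end IntegralCurves

noncomputable section OrbitMap

variable {E : Type*} [NormedAddCommGroup E] [NormedSpace ℝ E]
  {H : Type*} [TopologicalSpace H] (I : ModelWithCorners ℝ E H)
  {E' : Type*} [NormedAddCommGroup E'] [NormedSpace ℝ E']
  {H' : Type*} [TopologicalSpace H'] (I' : ModelWithCorners ℝ E' H')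
  (G : Type*) [TopologicalSpace G] [ChartedSpace H G] [Group G]
  {M : Type*} [TopologicalSpace M] [ChartedSpace H' M] [MulAction G M]

/-- The derivative at `1` of the orbit map `g ↦ g • x`, a linear map from the Lie algebra of `G` to
the tangent space of `M` at `x = 1 • x`. For fixed `v` in the Lie algebra, the vector field
`fun x ↦ orbitMFDeriv I I' G x v` is the fundamental vector field of `v`; if `M` is `G` itself, it
is the right-invariant vector field with value `v` at `1`. -/
def orbitMFDeriv (x : M) : GroupLieAlgebra I G →L[ℝ] TangentSpace I' x :=
  mfderiv I I' (fun g : G => g • x) 1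

variable {I I' G}

theorem orbitMFDeriv_one (v : GroupLieAlgebra I G) : orbitMFDeriv I I G (1 : G) v = v := by
  have hid : (fun g : G => g • (1 : G)) = id := funext mul_one
  have hderiv := (hasMFDerivAt_id (I := I) (1 : G)).congr_of_eventuallyEq (.of_eq hid)
  exact congrArg (fun A : E →L[ℝ] E => A v) hderiv.mfderiv

variable [ContMDiffSMul I I' ∞ G M]

theorem contMDiff_smul_left (x : M) : ContMDiff I I' ∞ (fun g : G => g • x) :=
  contMDiff_id.smul contMDiff_const

theorem mdifferentiableAt_smul_left (x : M) (g : G) :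
    MDifferentiableAt I I' (fun h : G => h • x) g :=
  (contMDiff_smul_left x).mdifferentiableAt (by simp)

variable [LieGroup I ∞ G]

theorem contMDiff_orbitMFDeriv [IsManifold I' 1 M] (v : GroupLieAlgebra I G) :
    ContMDiff I' I'.tangent ∞
      (fun x : M => (⟨x, orbitMFDeriv I I' G x v⟩ : TangentBundle I' M)) := by
  have hpartial := contMDiff_mfderiv_partial_left (m := ∞)
    (contMDiff_smul (I := I) (I' := I') (n := ∞) (G := G) (M := M)) (by simp) 1 v
  convert! hpartial using 2 with x
  exact congrArg (fun y : M => (⟨y, (orbitMFDeriv I I' G x v : E')⟩ : TangentBundle I' M))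
    (one_smul G x).symm

theorem mfderiv_smul_left_orbitMFDeriv (g : G) (x : M) (v : GroupLieAlgebra I G) :
    mfderiv I I' (fun h : G => h • x) g (orbitMFDeriv I I G g v) =
      orbitMFDeriv I I' G (g • x) v := by
  have hcomp : (fun h : G => h • x) ∘ (fun h : G => h • g) = fun h : G => h • g • x :=
    funext fun h => smul_assoc h g x
  have hchain := mfderiv_comp_apply_of_eq 1 (mdifferentiableAt_smul_left (I := I) (I' := I') x g)
    (mdifferentiableAt_smul_left g 1) (one_smul G g) v
  rw [hcomp] at hchain
  exact hchain.symm

theorem isMIntegralCurveOn_smul {v : GroupLieAlgebra I G} {γ : ℝ → G} {s : Set ℝ}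
    (hγ : IsMIntegralCurveOn γ (fun g : G => orbitMFDeriv I I G g v) s) (x : M) :
    IsMIntegralCurveOn (fun t => γ t • x) (fun y : M => orbitMFDeriv I I' G y v) s := by
  intro t ht
  have horbit := (mdifferentiableAt_smul_left (I := I) (I' := I') x (γ t)).hasMFDerivAt
  refine (horbit.comp_hasMFDerivWithinAt t (hγ t ht)).congr_mfderiv ?_
  refine ContinuousLinearMap.ext_ring ?_
  have hvelocity : (mfderiv I I' (fun h : G => h • x) (γ t) : E →L[ℝ] E')
      ((1 : ℝ) • (orbitMFDeriv I I G (γ t) v : E)) =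
        (1 : ℝ) • (orbitMFDeriv I I' G (γ t • x) v : E') := by
    rw [one_smul, one_smul]
    exact mfderiv_smul_left_orbitMFDeriv (γ t) x v
  exact hvelocity

theorem isMIntegralCurve_smul {v : GroupLieAlgebra I G} {γ : ℝ → G}
    (hγ : IsMIntegralCurve γ (fun g : G => orbitMFDeriv I I G g v)) (x : M) :
    IsMIntegralCurve (fun t => γ t • x) (fun y : M => orbitMFDeriv I I' G y v) :=
  isMIntegralCurve_iff_isMIntegralCurveOn.2
    (isMIntegralCurveOn_smul (isMIntegralCurve_iff_isMIntegralCurveOn.1 hγ) x)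

end OrbitMap

section OneParameterSubgroups

variable {E : Type*} [NormedAddCommGroup E] [NormedSpace ℝ E]
  {H : Type*} [TopologicalSpace H] {I : ModelWithCorners ℝ E H}
  {G : Type*} [TopologicalSpace G] [ChartedSpace H G] [Group G] [LieGroup I ∞ G]

theorem IsOneParameterSubgroup.isMIntegralCurve {v : GroupLieAlgebra I G} {γ : ℝ → G}
    (hγ : IsOneParameterSubgroup I γ v) :
    IsMIntegralCurve γ (fun g : G => orbitMFDeriv I I G g v) := by
  intro s
  have hdiff (t : ℝ) : MDifferentiableAt 𝓘(ℝ, ℝ) I γ t := hγ.smooth.mdifferentiableAt (by simp)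
  have htranslate : HasMFDerivAt 𝓘(ℝ, ℝ) 𝓘(ℝ, ℝ) (fun t : ℝ => t + s) 0
      (ContinuousLinearMap.id ℝ ℝ) :=
    ((hasFDerivAt_id 0).add_const s).hasMFDerivAt
  have hleft := mfderiv_comp_apply_of_eq 0 (hdiff s) htranslate.mdifferentiableAt (zero_add s)
    (1 : ℝ)
  have hright := mfderiv_comp_apply_of_eq 0 (mdifferentiableAt_smul_left (I' := I) (γ s) (1 : G))
    (hdiff 0) hγ.map_zero (1 : ℝ)
  have hcomp : γ ∘ (· + s) = (fun g : G => g • γ s) ∘ γ := funext fun t => hγ.map_add t s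
  rw [htranslate.mfderiv, hcomp] at hleft
  have hvelocity : (mfderiv 𝓘(ℝ, ℝ) I γ s : ℝ →L[ℝ] E) (1 : ℝ) = orbitMFDeriv I I G (γ s) v :=
    hleft.symm.trans (hright.trans (congrArg _ hγ.velocity))
  refine (hdiff s).hasMFDerivAt.congr_mfderiv (ContinuousLinearMap.ext_ring ?_)
  exact hvelocity.trans (one_smul ℝ (orbitMFDeriv I I G (γ s) v : E)).symm

variable [BoundarylessManifold I G] [T2Space G]

theorem isOneParameterSubgroup_of_isMIntegralCurve {v : GroupLieAlgebra I G} {γ : ℝ → G}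
    (h0 : γ 0 = 1) (hγ : IsMIntegralCurve γ (fun g : G => orbitMFDeriv I I G g v)) :
    IsOneParameterSubgroup I γ v where
  map_zero := h0
  map_add s t := by
    have heq := isMIntegralCurve_Ioo_eq_of_contMDiff_boundaryless (t₀ := 0)
      ((contMDiff_orbitMFDeriv v).of_le (by simp)) (hγ.comp_add t) (isMIntegralCurve_smul hγ (γ t))
      (by simp [h0])
    exact congrFun heq s
  smooth := contMDiff_of_isMIntegralCurve (contMDiff_orbitMFDeriv v) hγ
  velocity := by
    rw [(hγ 0).mfderiv]
    have hone : (1 : ℝ) • (orbitMFDeriv I I G (γ 0) v : E) = v := by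
      rw [one_smul, h0, orbitMFDeriv_one]
    exact hone

theorem IsOneParameterSubgroup.unique {v : GroupLieAlgebra I G} {γ γ' : ℝ → G}
    (hγ : IsOneParameterSubgroup I γ v) (hγ' : IsOneParameterSubgroup I γ' v) : γ = γ' :=
  isMIntegralCurve_Ioo_eq_of_contMDiff_boundaryless (t₀ := 0)
    ((contMDiff_orbitMFDeriv v).of_le (by simp)) hγ.isMIntegralCurve hγ'.isMIntegralCurve
    (hγ.map_zero.trans hγ'.map_zero.symm)

theorem IsOneParameterSubgroup.comp_mul {v : GroupLieAlgebra I G} {γ : ℝ → G}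
    (hγ : IsOneParameterSubgroup I γ v) (t : ℝ) :
    IsOneParameterSubgroup I (fun s => γ (s * t)) (t • v) := by
  refine isOneParameterSubgroup_of_isMIntegralCurve (by simp [hγ.map_zero]) ?_
  simp only [map_smul]
  exact hγ.isMIntegralCurve.comp_mul t

theorem IsOneParameterSubgroup.lieExp_smul {v : GroupLieAlgebra I G} {γ : ℝ → G}
    (hγ : IsOneParameterSubgroup I γ v) (t : ℝ) : lieExp I (t • v) = γ t := by
  have hexists : ∃ γ : ℝ → G, IsOneParameterSubgroup I γ (t • v) := ⟨_, hγ.comp_mul t⟩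
  rw [lieExp, dif_pos hexists, hexists.choose_spec.unique (hγ.comp_mul t)]
  exact congrArg γ (one_mul t)

theorem exists_isOneParameterSubgroup [CompleteSpace E] (v : GroupLieAlgebra I G) :
    ∃ γ : ℝ → G, IsOneParameterSubgroup I γ v := by
  have hsmooth := (contMDiff_orbitMFDeriv (I := I) (I' := I) (M := G) v).of_le (m := 1) (by simp)
  obtain ⟨γ, h0, hγ⟩ := exists_isMIntegralCurveAt_of_contMDiffAt_boundaryless (t₀ := 0)
    (hsmooth.contMDiffAt (x := 1))
  obtain ⟨ε, hε, hγ⟩ := isMIntegralCurveAt_iff'.1 hγ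
  rw [Real.ball_eq_Ioo, zero_sub, zero_add] at hγ
  obtain ⟨γ, h0, hγ⟩ := exists_isMIntegralCurve_of_isMIntegralCurveOn hsmooth hε
    (fun g => ⟨fun t => γ t • g, by simp [h0], isMIntegralCurveOn_smul hγ g⟩) 1
  exact ⟨γ, isOneParameterSubgroup_of_isMIntegralCurve h0 hγ⟩

theorem isOneParameterSubgroup_lieExp_smul [CompleteSpace E] (v : GroupLieAlgebra I G) :
    IsOneParameterSubgroup I (fun t : ℝ => lieExp I (t • v)) v := by
  obtain ⟨γ, hγ⟩ := exists_isOneParameterSubgroup v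
  simpa only [hγ.lieExp_smul] using hγ

end OneParameterSubgroups

section FundamentalVectorFields

variable {E : Type*} [NormedAddCommGroup E] [NormedSpace ℝ E] [CompleteSpace E]
  {H : Type*} [TopologicalSpace H] {I : ModelWithCorners ℝ E H}
  {E' : Type*} [NormedAddCommGroup E'] [NormedSpace ℝ E']
  {H' : Type*} [TopologicalSpace H'] {I' : ModelWithCorners ℝ E' H'}
  {G : Type*} [TopologicalSpace G] [ChartedSpace H G] [Group G] [LieGroup I ∞ G]
  [BoundarylessManifold I G] [T2Space G]
  {M : Type*} [TopologicalSpace M] [ChartedSpace H' M] [MulAction G M] [ContMDiffSMul I I' ∞ G M]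

theorem isMIntegralCurve_lieExp_smul (v : GroupLieAlgebra I G) (x : M) :
    IsMIntegralCurve (fun t : ℝ => lieExp I (t • v) • x)
      (fun y : M => orbitMFDeriv I I' G y v) :=
  isMIntegralCurve_smul (isOneParameterSubgroup_lieExp_smul v).isMIntegralCurve x

theorem infinitesimalAction_eq_orbitMFDeriv (v : GroupLieAlgebra I G) (x : M) :
    infinitesimalAction I I' v x = orbitMFDeriv I I' G x v := by
  have h0 : lieExp I ((0 : ℝ) • v) • x = x := by
    rw [(isOneParameterSubgroup_lieExp_smul v).map_zero, one_smul]
  rw [infinitesimalAction, (isMIntegralCurve_lieExp_smul v x 0).mfderiv]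
  have hone : (1 : ℝ) • (orbitMFDeriv I I' G (lieExp I ((0 : ℝ) • v) • x) v : E') =
      orbitMFDeriv I I' G x v := by rw [one_smul, h0]
  exact hone

theorem isSmoothVectorField_infinitesimalAction [IsManifold I' ∞ M] (v : GroupLieAlgebra I G) :
    IsSmoothVectorField I' (infinitesimalAction I I' v : ∀ x : M, TangentSpace I' x) := by
  simp only [IsSmoothVectorField, infinitesimalAction_eq_orbitMFDeriv]
  exact contMDiff_orbitMFDeriv v

theorem lieExp_smul_eq_self [IsManifold I' 1 M] [BoundarylessManifold I' M] [T2Space M]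
    {v : GroupLieAlgebra I G} {x : M} (hv : orbitMFDeriv I I' G x v = 0) :
    lieExp I v • x = x := by
  have hconst : IsMIntegralCurve (fun _ : ℝ => x) (fun y : M => orbitMFDeriv I I' G y v) :=
    isMIntegralCurve_const hv
  have heq := isMIntegralCurve_Ioo_eq_of_contMDiff_boundaryless (t₀ := 0)
    ((contMDiff_orbitMFDeriv v).of_le (by simp)) (isMIntegralCurve_lieExp_smul v x) hconst
    (by simp only [(isOneParameterSubgroup_lieExp_smul v).map_zero, one_smul])
  simpa only [one_smul] using congrFun heq 1

end FundamentalVectorFields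

noncomputable section SecondKind

variable {E : Type*} [NormedAddCommGroup E] [NormedSpace ℝ E]
  {H : Type*} [TopologicalSpace H] {I : ModelWithCorners ℝ E H}
  {G : Type*} [TopologicalSpace G] [ChartedSpace H G]

theorem contMDiff_list_prod_map [Monoid G] {n : ℕ∞ω} [ContMDiffMul I n G]
    {E' : Type*} [NormedAddCommGroup E'] [NormedSpace ℝ E']
    {H' : Type*} [TopologicalSpace H'] {I' : ModelWithCorners ℝ E' H'}
    {N : Type*} [TopologicalSpace N] [ChartedSpace H' N] {ι : Type*} {f : ι → N → G}
    (hf : ∀ i, ContMDiff I' I n (f i)) (l : List ι) :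
    ContMDiff I' I n (fun p => (l.map fun i => f i p).prod) := by
  induction l with
  | nil => exact contMDiff_const
  | cons i l ih =>
    simp only [List.map_cons, List.prod_cons]
    exact (hf i).mul ih

variable [Group G]

variable (I) in
/-- The canonical coordinates of the second kind attached to `v₁, …, vₖ` in the Lie algebra of `G`:
the map `t ↦ exp(t₁v₁) ⋯ exp(tₖvₖ)`. -/
def lieExpProd {k : ℕ} (v : Fin k → GroupLieAlgebra I G) (t : Fin k → ℝ) : G :=
  ((List.finRange k).map fun i => lieExp I (t i • v i)).prod

variable [LieGroup I ∞ G] [T2Space G] [CompleteSpace E] {k : ℕ}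

section

variable [BoundarylessManifold I G]

theorem lieExp_zero : lieExp I (0 : GroupLieAlgebra I G) = 1 := by
  simpa only [zero_smul] using
    (isOneParameterSubgroup_lieExp_smul (0 : GroupLieAlgebra I G)).map_zero

theorem contMDiff_lieExpProd (v : Fin k → GroupLieAlgebra I G) :
    ContMDiff 𝓘(ℝ, Fin k → ℝ) I ∞ (lieExpProd I v) :=
  contMDiff_list_prod_map (fun i => (isOneParameterSubgroup_lieExp_smul (v i)).smooth.comp
    (contDiff_apply ℝ ℝ i).contMDiff) _

theorem lieExpProd_zero (v : Fin k → GroupLieAlgebra I G) : lieExpProd I v 0 = 1 := by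
  refine List.prod_eq_one fun g hg => ?_
  obtain ⟨i, -, rfl⟩ := List.mem_map.1 hg
  rw [Pi.zero_apply, zero_smul, lieExp_zero]

theorem lieExpProd_smul_single (v : Fin k → GroupLieAlgebra I G) (i : Fin k) (t : ℝ) :
    lieExpProd I v (t • Pi.single i 1) = lieExp I (t • v i) := by
  rw [lieExpProd, List.prod_map_eq_pow_single i, List.count_finRange, pow_one]
  · simp only [Pi.smul_apply, Pi.single_eq_same, smul_eq_mul, mul_one]
  · intro j hj _
    simp only [Pi.smul_apply, Pi.single_eq_of_ne hj, smul_zero, zero_smul, lieExp_zero]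

theorem mfderiv_eq_of_forall_lieExp {V : Type*} [NormedAddCommGroup V] [NormedSpace ℝ V]
    {f : V → G} (hf : MDifferentiableAt 𝓘(ℝ, V) I f 0) {c : V} {v : GroupLieAlgebra I G}
    (hfc : ∀ t : ℝ, f (t • c) = lieExp I (t • v)) : mfderiv 𝓘(ℝ, V) I f 0 c = v := by
  have hline : HasMFDerivAt 𝓘(ℝ, ℝ) 𝓘(ℝ, V) (fun t : ℝ => t • c) 0
      (ContinuousLinearMap.toSpanSingleton ℝ c) :=
    (ContinuousLinearMap.toSpanSingleton ℝ c).hasFDerivAt.hasMFDerivAt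
  have hchain := mfderiv_comp_apply_of_eq 0 hf hline.mdifferentiableAt (zero_smul ℝ c) (1 : ℝ)
  rw [hline.mfderiv, show f ∘ (fun t : ℝ => t • c) = fun t : ℝ => lieExp I (t • v) from
    funext hfc] at hchain
  let A : V →L[ℝ] E := mfderiv 𝓘(ℝ, V) I f 0
  have hc : A (ContinuousLinearMap.toSpanSingleton ℝ c 1) = A c := by
    rw [ContinuousLinearMap.toSpanSingleton_apply, one_smul]
  exact hc.symm.trans (hchain.symm.trans (isOneParameterSubgroup_lieExp_smul v).velocity)

theorem lieExpProd_smul_eq_self {E' : Type*} [NormedAddCommGroup E'] [NormedSpace ℝ E']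
    {H' : Type*} [TopologicalSpace H'] {I' : ModelWithCorners ℝ E' H'}
    {M : Type*} [TopologicalSpace M] [ChartedSpace H' M] [IsManifold I' 1 M]
    [BoundarylessManifold I' M] [T2Space M] [MulAction G M] [ContMDiffSMul I I' ∞ G M]
    {v : Fin k → GroupLieAlgebra I G} {x : M} (hv : ∀ i, orbitMFDeriv I I' G x (v i) = 0)
    (t : Fin k → ℝ) : lieExpProd I v t • x = x := by
  refine (MulAction.stabilizer G x).list_prod_mem fun g hg => ?_
  obtain ⟨i, -, rfl⟩ := List.mem_map.1 hg
  refine lieExp_smul_eq_self (I' := I') ?_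
  rw [map_smul, hv, smul_zero]

end

theorem map_lieExpProd_mul_lieExpProd_nhds [I.Boundaryless] {r : ℕ}
    {u : Fin r → GroupLieAlgebra I G} {w : Fin k → GroupLieAlgebra I G}
    (huw : Submodule.span ℝ (range u) ⊔ Submodule.span ℝ (range w) = ⊤) :
    Filter.map (fun p : (Fin r → ℝ) × (Fin k → ℝ) => lieExpProd I u p.1 * lieExpProd I w p.2)
      (𝓝 0) = 𝓝 1 := by
  set F := fun p : (Fin r → ℝ) × (Fin k → ℝ) => lieExpProd I u p.1 * lieExpProd I w p.2 with hF
  have hsmooth : ContMDiff 𝓘(ℝ, (Fin r → ℝ) × (Fin k → ℝ)) I ∞ F :=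
    ((contMDiff_lieExpProd u).comp contDiff_fst.contMDiff).mul
      ((contMDiff_lieExpProd w).comp contDiff_snd.contMDiff)
  have hdiff := hsmooth.mdifferentiableAt (x := 0) (by simp)
  let A : (Fin r → ℝ) × (Fin k → ℝ) →L[ℝ] GroupLieAlgebra I G :=
    mfderiv 𝓘(ℝ, (Fin r → ℝ) × (Fin k → ℝ)) I F 0
  have hu : Submodule.span ℝ (range u) ≤ A.range := by
    refine Submodule.span_le.2 (range_subset_iff.2 fun i => ⟨(Pi.single i 1, 0), ?_⟩)
    refine mfderiv_eq_of_forall_lieExp hdiff fun t => ?_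
    simp only [hF, Prod.smul_mk, smul_zero, lieExpProd_zero, mul_one, lieExpProd_smul_single]
  have hw : Submodule.span ℝ (range w) ≤ A.range := by
    refine Submodule.span_le.2 (range_subset_iff.2 fun i => ⟨(0, Pi.single i 1), ?_⟩)
    refine mfderiv_eq_of_forall_lieExp hdiff fun t => ?_
    simp only [hF, Prod.smul_mk, smul_zero, lieExpProd_zero, one_mul, lieExpProd_smul_single]
  have hsurj : Function.Surjective A :=
    LinearMap.range_eq_top.1 (top_le_iff.1 (huw ▸ sup_le hu hw))
  have hF0 : F 0 = 1 := by
    simp only [hF, Prod.fst_zero, Prod.snd_zero, lieExpProd_zero, mul_one]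
  rw [← hF0]
  exact map_nhds_eq_of_mfderiv_surjective (hsmooth.of_le (by simp) 0) hsurj

end SecondKind

section Submersion

variable {E : Type*} [NormedAddCommGroup E] [NormedSpace ℝ E]
  {H : Type*} [TopologicalSpace H] {I : ModelWithCorners ℝ E H} [I.Boundaryless]
  {E' : Type*} [NormedAddCommGroup E'] [NormedSpace ℝ E'] [FiniteDimensional ℝ E']
  {H' : Type*} [TopologicalSpace H'] {I' : ModelWithCorners ℝ E' H'} [I'.Boundaryless]
  {G : Type*} [TopologicalSpace G] [ChartedSpace H G] [Group G] [LieGroup I ∞ G] [T2Space G]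
  {M : Type*} [TopologicalSpace M] [ChartedSpace H' M] [IsManifold I' 1 M] [T2Space M]
  [MulAction G M] [ContMDiffSMul I I' ∞ G M]

theorem finrank_le_of_span_sup_span_eq_top [CompleteSpace E] {x : M}
    (hopen : 𝓝 x ≤ Filter.map (fun g : G => g • x) (𝓝 1)) {r k : ℕ}
    {u : Fin r → GroupLieAlgebra I G} {w : Fin k → GroupLieAlgebra I G}
    (huw : Submodule.span ℝ (range u) ⊔ Submodule.span ℝ (range w) = ⊤)
    (hw : ∀ i, orbitMFDeriv I I' G x (w i) = 0) : finrank ℝ E' ≤ r := by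
  let f : (Fin r → ℝ) → M := fun s => lieExpProd I u s • x
  have hf : ContMDiff 𝓘(ℝ, Fin r → ℝ) I' ∞ f :=
    (contMDiff_smul_left x).comp (contMDiff_lieExpProd u)
  have hfst : (fun g : G => g • x) ∘ (fun p : (Fin r → ℝ) × (Fin k → ℝ) =>
      lieExpProd I u p.1 * lieExpProd I w p.2) = f ∘ Prod.fst :=
    funext fun p => by
      simp only [f, Function.comp_apply, mul_smul, lieExpProd_smul_eq_self hw]
  have hf0 : f 0 = x := by simp only [f, lieExpProd_zero, one_smul]
  have hle : 𝓝 (f 0) ≤ Filter.map f (𝓝 0) := by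
    rw [hf0]
    refine hopen.trans ?_
    rw [← map_lieExpProd_mul_lieExpProd_nhds huw, Filter.map_map, hfst, ← Filter.map_map]
    exact Filter.map_mono continuous_fst.continuousAt
  simpa only [finrank_fin_fun] using finrank_le_of_nhds_le_map_nhds (hf.of_le (by simp) 0) hle

variable [FiniteDimensional ℝ E]

theorem orbitMFDeriv_surjective_of_nhds_le {x : M}
    (hopen : 𝓝 x ≤ Filter.map (fun g : G => g • x) (𝓝 1)) :
    Function.Surjective (orbitMFDeriv I I' G x) := by
  have : CompleteSpace E := FiniteDimensional.complete ℝ E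
  have : FiniteDimensional ℝ (GroupLieAlgebra I G) := inferInstanceAs (FiniteDimensional ℝ E)
  have : FiniteDimensional ℝ (TangentSpace I' x) := inferInstanceAs (FiniteDimensional ℝ E')
  let D : GroupLieAlgebra I G →ₗ[ℝ] TangentSpace I' x := orbitMFDeriv I I' G x
  obtain ⟨S, hS⟩ := D.ker.exists_isCompl
  have hspan (T : Submodule ℝ (GroupLieAlgebra I G)) :
      Submodule.span ℝ (range fun i => (finBasis ℝ T i : GroupLieAlgebra I G)) = T := by
    rw [range_comp' Subtype.val, ← Submodule.coe_subtype, Submodule.span_image,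
      (finBasis ℝ T).span_eq, Submodule.map_subtype_top]
  have hdim : finrank ℝ E' ≤ finrank ℝ S :=
    finrank_le_of_span_sup_span_eq_top hopen (by rw [hspan S, hspan D.ker, hS.symm.sup_eq_top])
      fun i => (finBasis ℝ D.ker i).2
  have hrange : finrank ℝ S = finrank ℝ D.range :=
    ((Submodule.quotientEquivOfIsCompl _ _ hS).symm.trans D.quotKerEquivRange).finrank_eq
  exact LinearMap.range_eq_top.1
    (Submodule.eq_top_of_finrank_eq (D.range.finrank_le.antisymm (hdim.trans_eq hrange)))

theorem orbitMFDeriv_surjective [SigmaCompactSpace G] [MulAction.IsPretransitive G M] (x : M) :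
    Function.Surjective (orbitMFDeriv I I' G x) := by
  have : IsTopologicalGroup G := topologicalGroup_of_lieGroup I ∞
  have : ContinuousSMul G M := ContMDiffSMul.continuousSMul (I := I) (I' := I') ∞
  have : LocallyCompactSpace M := Manifold.locallyCompact_of_finiteDimensional I'
  refine orbitMFDeriv_surjective_of_nhds_le ?_
  simpa only [one_smul] using (isOpenMap_smul_of_sigmaCompact x).nhds_le (1 : G)

end Submersion

section Generators

variable {𝕜 : Type*} [NontriviallyNormedField 𝕜] [CompleteSpace 𝕜]
  {E : Type*} [NormedAddCommGroup E] [NormedSpace 𝕜 E]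
  {H : Type*} [TopologicalSpace H] {I : ModelWithCorners 𝕜 E H}
  {M : Type*} [TopologicalSpace M] [ChartedSpace H M]
  {F : Type*} [NormedAddCommGroup F] [NormedSpace 𝕜 F] [FiniteDimensional 𝕜 F]
  {n : ℕ∞ω} {s : Set M} {x₀ : M}

theorem exists_contMDiffOn_rightInverse {F' : Type*} [NormedAddCommGroup F'] [NormedSpace 𝕜 F']
    {A : M → F' →L[𝕜] F} (hs : IsOpen s) (hA : ContMDiffOn I 𝓘(𝕜, F' →L[𝕜] F) n A s)
    (hx₀ : x₀ ∈ s) (hsurj : Function.Surjective (A x₀)) :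
    ∃ U ⊆ s, U ∈ 𝓝 x₀ ∧ ∃ S : M → F →L[𝕜] F', ContMDiffOn I 𝓘(𝕜, F →L[𝕜] F') n S U ∧
      ∀ x ∈ U, ∀ z, A x (S x z) = z := by
  have : CompleteSpace F := FiniteDimensional.complete 𝕜 F
  obtain ⟨S, hS⟩ := LinearMap.exists_rightInverse_of_surjective (A x₀ : F' →ₗ[𝕜] F)
    (LinearMap.range_eq_top.2 hsurj)
  let S₀ : F →L[𝕜] F' := LinearMap.toContinuousLinearMap S
  let B : M → F →L[𝕜] F := fun x => A x ∘L S₀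
  have hB : ContMDiffOn I 𝓘(𝕜, F →L[𝕜] F) n B s := hA.clm_comp contMDiffOn_const
  have hBx₀ : B x₀ = 1 := ContinuousLinearMap.ext (LinearMap.congr_fun hS)
  have hU : IsOpen (s ∩ B ⁻¹' {T | IsUnit T}) :=
    hB.continuousOn.isOpen_inter_preimage hs Units.isOpen
  refine ⟨_, inter_subset_left, hU.mem_nhds ⟨hx₀, by simp [hBx₀]⟩,
    fun x => S₀ ∘L Ring.inverse (B x), fun x hx => ?_, fun x hx z => ?_⟩
  · obtain ⟨T, hT⟩ := hx.2
    have hinv : ContDiffAt 𝕜 n Ring.inverse (B x) := hT ▸ contDiffAt_ringInverse 𝕜 T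
    exact contMDiffWithinAt_const.clm_comp
      (hinv.contMDiffAt.comp_contMDiffWithinAt x ((hB x hx.1).mono inter_subset_left))
  · exact congrArg (fun T : F →L[𝕜] F => T z) (Ring.mul_inverse_cancel (B x) hx.2)

variable {ι : Type*} [Fintype ι]

theorem exists_contMDiffOn_coefficients {a : ι → M → F} {y : M → F} (hs : IsOpen s)
    (ha : ∀ i, ContMDiffOn I 𝓘(𝕜, F) n (a i) s) (hy : ContMDiffOn I 𝓘(𝕜, F) n y s) (hx₀ : x₀ ∈ s)
    (hspan : Submodule.span 𝕜 (range fun i => a i x₀) = ⊤) :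
    ∃ U ⊆ s, U ∈ 𝓝 x₀ ∧ ∃ c : M → ι → 𝕜, ContMDiffOn I 𝓘(𝕜, ι → 𝕜) n c U ∧
      ∀ x ∈ U, y x = ∑ i, c x i • a i x := by
  let A : M → (ι → 𝕜) →L[𝕜] F := fun x =>
    ∑ i, (ContinuousLinearMap.proj (R := 𝕜) (φ := fun _ : ι => 𝕜) i).smulRight (a i x)
  have hA_apply (x : M) (c : ι → 𝕜) : A x c = ∑ i, c i • a i x := by
    simp only [A, _root_.sum_apply, ContinuousLinearMap.smulRight_apply,
      ContinuousLinearMap.proj_apply]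
  have hA : ContMDiffOn I 𝓘(𝕜, (ι → 𝕜) →L[𝕜] F) n A s :=
    contMDiffOn_finsetSum fun i _ => (ContinuousLinearMap.smulRightL 𝕜 (ι → 𝕜) F
      (ContinuousLinearMap.proj i)).contDiff.contMDiff.comp_contMDiffOn (ha i)
  have hsurj : Function.Surjective (A x₀) := fun z => by
    obtain ⟨c, hc⟩ :=
      (Submodule.mem_span_range_iff_exists_fun 𝕜).1 (hspan.ge (Submodule.mem_top (x := z)))
    exact ⟨c, (hA_apply x₀ c).trans hc⟩
  obtain ⟨U, hUs, hU, S, hS, hAS⟩ := exists_contMDiffOn_rightInverse hs hA hx₀ hsurj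
  exact ⟨U, hUs, hU, fun x => S x (y x), hS.clm_apply (hy.mono hUs), fun x hx => by
    rw [← hA_apply, hAS x hx]⟩

theorem exists_contMDiffOn_section_coefficients {V : M → Type*} [TopologicalSpace (TotalSpace F V)]
    [∀ x, AddCommGroup (V x)] [∀ x, Module 𝕜 (V x)] [∀ x, TopologicalSpace (V x)]
    [FiberBundle F V] [VectorBundle 𝕜 F V] [ContMDiffVectorBundle n F V I]
    {X : ι → ∀ x, V x} {Y : ∀ x, V x}
    (hX : ∀ i, ContMDiff I (I.prod 𝓘(𝕜, F)) n fun x => TotalSpace.mk' F x (X i x))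
    (hY : ContMDiff I (I.prod 𝓘(𝕜, F)) n fun x => TotalSpace.mk' F x (Y x))
    (hspan : Submodule.span 𝕜 (range fun i => X i x₀) = ⊤) :
    ∃ U ∈ 𝓝 x₀, ∃ c : M → ι → 𝕜, ContMDiffOn I 𝓘(𝕜, ι → 𝕜) n c U ∧
      ∀ x ∈ U, Y x = ∑ i, c x i • X i x := by
  let e := trivializationAt F V x₀
  have hx₀ : x₀ ∈ e.baseSet := mem_baseSet_trivializationAt F V x₀
  have hspan_e : Submodule.span 𝕜 (range fun i => (e ⟨x₀, X i x₀⟩).2) = ⊤ := by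
    have hmap := congrArg (Submodule.map (e.linearEquivAt 𝕜 x₀ hx₀).toLinearMap) hspan
    rw [Submodule.map_span, ← range_comp, Submodule.map_top, LinearEquiv.range] at hmap
    exact hmap
  obtain ⟨U, hUe, hU, c, hc, hYc⟩ := exists_contMDiffOn_coefficients e.open_baseSet
    (fun i => e.contMDiffOn_section_baseSet_iff.1 (hX i).contMDiffOn)
    (e.contMDiffOn_section_baseSet_iff.1 hY.contMDiffOn) hx₀ hspan_e
  refine ⟨U, hU, c, hc, fun x hx => (e.linearEquivAt 𝕜 x (hUe hx)).injective ?_⟩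
  rw [map_sum]
  simp only [map_smul]
  exact hYc x hx

end Generators

section GeneratingSets

variable {E : Type*} [NormedAddCommGroup E] [NormedSpace ℝ E] [FiniteDimensional ℝ E]
  {H : Type*} [TopologicalSpace H] {I : ModelWithCorners ℝ E H}
  {M : Type*} [TopologicalSpace M] [ChartedSpace H M] [IsManifold I ∞ M]

theorem IsGeneratingSet.of_forall_span_eq_top [T2Space M] [SigmaCompactSpace M]
    {m : ℕ} {X : Fin m → ∀ x : M, TangentSpace I x} (hX : ∀ i, IsSmoothVectorField I (X i))
    (hspan : ∀ x, Submodule.span ℝ (range fun i => X i x) = ⊤) : IsGeneratingSet I X := by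
  refine ⟨hX, fun Y hY => ?_⟩
  have hconvex (x : M) : Convex ℝ {c : Fin m → ℝ | Y x = ∑ i, c i • X i x} := by
    intro c hc d hd s t _ _ hst
    simp only [mem_ofPred_eq, Pi.add_apply, Pi.smul_apply, smul_eq_mul] at hc hd ⊢
    simp only [add_smul, mul_smul, Finset.sum_add_distrib, ← Finset.smul_sum]
    rw [← hc, ← hd, ← add_smul, hst, one_smul]
  obtain ⟨f, hf⟩ := exists_contMDiffMap_forall_mem_convex_of_local I (n := (⊤ : ℕ∞)) hconvex
    fun x => exists_contMDiffOn_section_coefficients hX hY (hspan x)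
  exact ⟨fun i x => f x i, contMDiff_pi_space.1 f.contMDiff, hf⟩

end GeneratingSets

theorem sigmaCompactSpace_of_isPretransitive (G : Type*) {M : Type*} [TopologicalSpace G]
    [SigmaCompactSpace G] [Group G] [TopologicalSpace M] [MulAction G M] [ContinuousSMul G M]
    [MulAction.IsPretransitive G M] : SigmaCompactSpace M := by
  rcases isEmpty_or_nonempty M with _ | ⟨⟨x⟩⟩
  · infer_instance
  · have hcont : Continuous fun g : G => g • x := continuous_id.smul continuous_const
    have hrange := isSigmaCompact_range hcont
    rwa [(MulAction.surjective_smul G x).range_eq, isSigmaCompact_univ_iff] at hrange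

theorem mainTheorem7_general
    {E : Type*} [NormedAddCommGroup E] [NormedSpace ℝ E] [FiniteDimensional ℝ E]
    {H : Type*} [TopologicalSpace H] (I : ModelWithCorners ℝ E H) [I.Boundaryless]
    {E' : Type*} [NormedAddCommGroup E'] [NormedSpace ℝ E'] [FiniteDimensional ℝ E']
    {H' : Type*} [TopologicalSpace H'] (I' : ModelWithCorners ℝ E' H') [I'.Boundaryless]
    (G : Type*) [TopologicalSpace G] [ChartedSpace H G] [Group G] [LieGroup I ∞ G]
    [T2Space G] [SigmaCompactSpace G]
    (M : Type*) [TopologicalSpace M] [ChartedSpace H' M] [IsManifold I' ∞ M] [T2Space M]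
    [MulAction G M] [ContMDiffSMul I I' ∞ G M] [MulAction.IsPretransitive G M]
    {m : ℕ} {v : Fin m → GroupLieAlgebra I G} (hv : Submodule.span ℝ (range v) = ⊤) :
    (∀ (i : Fin m) (x : M),
      MDifferentiableAt 𝓘(ℝ, ℝ) I' (fun t : ℝ => lieExp I (t • v i) • x) 0) ∧
    IsGeneratingSet I'
      (fun i : Fin m => (infinitesimalAction I I' (v i) : ∀ x : M, TangentSpace I' x)) := by
  have : CompleteSpace E := FiniteDimensional.complete ℝ E
  have : ContinuousSMul G M := ContMDiffSMul.continuousSMul (I := I) (I' := I') ∞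
  have : SigmaCompactSpace M := sigmaCompactSpace_of_isPretransitive G
  refine ⟨fun i x => (isMIntegralCurve_lieExp_smul (v i) x 0).mdifferentiableAt,
    .of_forall_span_eq_top (fun i => isSmoothVectorField_infinitesimalAction (v i)) fun x => ?_⟩
  let D : GroupLieAlgebra I G →ₗ[ℝ] TangentSpace I' x := orbitMFDeriv I I' G x
  have hD : D.range = ⊤ := LinearMap.range_eq_top.2 (orbitMFDeriv_surjective x)
  simp only [infinitesimalAction_eq_orbitMFDeriv]
  rw [← hD, ← Submodule.map_top, ← hv, Submodule.map_span, ← range_comp]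
  rfl

/-- `G` is a Lie group acting smoothly and transitively on the smooth manifold `M` (both
finite-dimensional, without boundary, Hausdorff and second countable), and `b` is a basis of its Lie
algebra. The curves `t ↦ exp(t bᵢ) • x` are differentiable at `0`, and the vector fields on `M` that
their velocities define form a generating set of the module of smooth vector fields. -/
theorem mainTheorem7
    {E : Type*} [NormedAddCommGroup E] [NormedSpace ℝ E] [FiniteDimensional ℝ E]
    {H : Type*} [TopologicalSpace H] (I : ModelWithCorners ℝ E H) [I.Boundaryless]
    {E' : Type*} [NormedAddCommGroup E'] [NormedSpace ℝ E'] [FiniteDimensional ℝ E']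
    {H' : Type*} [TopologicalSpace H'] (I' : ModelWithCorners ℝ E' H') [I'.Boundaryless]
    (G : Type*) [TopologicalSpace G] [ChartedSpace H G] [Group G] [LieGroup I ∞ G]
    [T2Space G] [SecondCountableTopology G]
    (M : Type*) [TopologicalSpace M] [ChartedSpace H' M] [IsManifold I' ∞ M]
    [T2Space M] [SecondCountableTopology M]
    [MulAction G M] [ContMDiffSMul I I' ∞ G M] [MulAction.IsPretransitive G M]
    {m : ℕ} (b : Module.Basis (Fin m) ℝ (GroupLieAlgebra I G)) :
    (∀ (i : Fin m) (x : M),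
      MDifferentiableAt 𝓘(ℝ, ℝ) I' (fun t : ℝ => lieExp I (t • b i) • x) 0) ∧
    IsGeneratingSet I'
      (fun i : Fin m => (infinitesimalAction I I' (b i) : ∀ x : M, TangentSpace I' x)) := by
  have : LocallyCompactSpace G := Manifold.locallyCompact_of_finiteDimensional I
  exact mainTheorem7_general I I' G M b.span_eq
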